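/- Let $X=[0,1[$ and let $\widehat{\mathrm{PC}^{\bowtie}}$ be the group of all bijections of $X$ that are continuous outside a finite set. Let $\mathfrak S_{\mathrm{fin}}\subset\widehat{\mathrm{PC}^{\bowtie}}$ be the normal subgroup of finitely supported permutations of $X$, let $\varepsilon_{\mathrm{fin}}:\mathfrak S_{\mathrm{fin}}\to\mathbb Z/2\mathbb Z$ be the classical signature, let $\mathfrak A_{\mathrm{fin}}=\operatorname{Ker}(\varepsilon_{\mathrm{fin}})$, and let $\mathrm{PC}^{\bowtie}=\widehat{\mathrm{PC}^{\bowtie}}/\mathfrak S_{\mathrm{fin}}$. For $h\in\widehat{\mathrm{PC}^{\bowtie}}$, let $\mathcal P=\{I_1,\dots,I_n\}$ be the minimal finite partition of $X$ into nonempty intervals $I_j=[\alpha_j,\alpha'_j[$ such that $h$ is continuous on the interior $I_j^\circ=]\alpha_j,\alpha'_j[$ of each $I_j$. Let $R(h)$ be the number of $j$ such that $h$ is order-reversing on $I_j^\circ$, let $\beta_j$ be the left endpoint of the interval $h(I_j^\circ)$, and let $\sigma_h\in\mathfrak S_{\mathrm{fin}}$ be the permutation that sends $h(\alpha_j)$ to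 $\beta_j$ for every $j$ and fixes all other points. Put $\varepsilon(h)=R(h)+\varepsilon_{\mathrm{fin}}(\sigma_h)\in\mathbb Z/2\mathbb Z$. Theorem. The map $\varepsilon:\widehat{\mathrm{PC}^{\bowtie}}\to\mathbb Z/2\mathbb Z$ is a group homomorphism. Let $\widehat G$ be a subgroup of $\widehat{\mathrm{PC}^{\bowtie}}$ that contains $\mathfrak S_{\mathrm{fin}}$ and whose projection $G$ in $\mathrm{PC}^{\bowtie}$ is simple and nonabelian. Then $\widehat G$ has exactly five normal subgroups, namely $\{1\}$, $\mathfrak A_{\mathrm{fin}}$, $\mathfrak S_{\mathrm{fin}}$, $\operatorname{Ker}(\varepsilon|_{\widehat G})$ and $\widehat G$. -/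

import Mathlib

namespace PC

/-! ### The interval and its groups of permutations -/

/-- The right-open, left-closed interval `X = [0,1[`, with the topology and order of `ℝ`. -/
abbrev X : Type := Set.Ico (0 : ℝ) 1

/-- A continuous injection near `x ≠ 0` is strictly monotone near `x`. -/
theorem exists_Icc_strictMonoOn {h : X → X} (hinj : Function.Injective h) {x : X} (hx : x ≠ 0)
    (hc : ∀ᶠ y in nhds x, ContinuousAt h y) {V : Set X} (hV : V ∈ nhds x) :
    ∃ a b : X, a < x ∧ x < b ∧ Set.Icc a b ⊆ V ∧ ContinuousOn h (Set.Icc a b) ∧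
      (StrictMonoOn h (Set.Icc a b) ∨ StrictAntiOn h (Set.Icc a b)) := by
  have : Inhabited X := ⟨0⟩
  have h0 : (0 : X) < x := lt_of_le_of_ne (by exact_mod_cast x.2.1) (Ne.symm hx)
  have h1 : ∃ u : X, x < u := by
    obtain ⟨u, hu1, hu2⟩ := exists_between x.2.2
    exact ⟨⟨u, x.2.1.trans hu1.le, hu2⟩, hu1⟩
  have hV' : {y | y ∈ V ∧ ContinuousAt h y} ∈ nhds x := Filter.inter_mem hV hc
  obtain ⟨l, u, ⟨hl, hu⟩, hsub⟩ := (mem_nhds_iff_exists_Ioo_subset' ⟨0, h0⟩ h1).1 hV'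
  obtain ⟨a, hla, hax⟩ := exists_between hl
  obtain ⟨b, hxb, hbu⟩ := exists_between hu
  have hab : a ≤ b := (hax.trans hxb).le
  have hI : Set.Icc a b ⊆ {y | y ∈ V ∧ ContinuousAt h y} := fun y hy =>
    hsub ⟨hla.trans_le hy.1, hy.2.trans_lt hbu⟩
  have hcont : ContinuousOn h (Set.Icc a b) := fun y hy => (hI hy).2.continuousWithinAt
  exact ⟨a, b, hax, hxb, fun y hy => (hI hy).1, hcont,
    hcont.strictMonoOn_of_injOn_Icc' hab hinj.injOn⟩

/-- A continuous injection near `x ≠ 0` is open at `x`. -/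
theorem nhds_le_map {h : X → X} (hinj : Function.Injective h) {x : X} (hx : x ≠ 0)
    (hc : ∀ᶠ y in nhds x, ContinuousAt h y) : nhds (h x) ≤ Filter.map h (nhds x) := by
  have : Inhabited X := ⟨0⟩
  intro V hV
  obtain ⟨a, b, hax, hxb, hI, hcont, hmono⟩ := exists_Icc_strictMonoOn hinj hx hc hV
  have hab : a ≤ b := (hax.trans hxb).le
  have ha : a ∈ Set.Icc a b := ⟨le_rfl, hab⟩
  have hb : b ∈ Set.Icc a b := ⟨hab, le_rfl⟩
  have hxm : x ∈ Set.Icc a b := ⟨hax.le, hxb.le⟩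
  rcases hmono with hm | hm
  · filter_upwards [Icc_mem_nhds (hm ha hxm hax) (hm hxm hb hxb)] with y hy
    obtain ⟨z, hz, rfl⟩ := intermediate_value_Icc hab hcont hy
    exact hI hz
  · filter_upwards [Icc_mem_nhds (hm hxm hb hxb) (hm ha hxm hax)] with y hy
    obtain ⟨z, hz, rfl⟩ := intermediate_value_Icc' hab hcont hy
    exact hI hz

theorem nhds_cofinite {F : Set X} (hF : F.Finite) {x : X} (hx : x ∉ F) :
    ∀ᶠ y in nhds x, y ∉ F :=
  hF.isClosed.isOpen_compl.mem_nhds hx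

/-- The group of all bijections of `[0,1[` that are continuous outside a finite set. -/
def PChat : Subgroup (Equiv.Perm X) where
  carrier := {h | {x | ¬ ContinuousAt h x}.Finite}
  one_mem' := by
    have : {x : X | ¬ ContinuousAt (1 : Equiv.Perm X) x} = ∅ := by
      ext x
      simpa using (continuousAt_id : ContinuousAt (id : X → X) x)
    simp only [Set.mem_ofPred_eq, this, Set.finite_empty]
  mul_mem' := by
    intro f g hf hg
    refine (Set.Finite.union hg (hf.preimage g.injective.injOn)).subset ?_
    intro x hx
    by_contra hcon
    simp only [Set.mem_union, Set.mem_ofPred_eq, Set.mem_preimage, not_or, not_not] at hcon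
    exact hx (ContinuousAt.comp (g := f) (f := g) hcon.2 hcon.1)
  inv_mem' := by
    intro h hh
    have hF : (insert (0 : X) {x | ¬ ContinuousAt h x}).Finite := Set.Finite.insert 0 hh
    refine (hF.image h).subset ?_
    intro y hy
    by_contra hcon
    apply hy
    obtain ⟨x, rfl⟩ := h.surjective y
    have hx : x ∉ insert (0 : X) {x | ¬ ContinuousAt h x} := fun hx => hcon ⟨x, hx, rfl⟩
    have hev : ∀ᶠ z in nhds x, ContinuousAt h z := by
      filter_upwards [nhds_cofinite hF hx] with z hz
      by_contra hz'
      exact hz (Or.inr hz')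
    have hle := nhds_le_map h.injective (fun h0 => hx (Or.inl h0)) hev
    have : Filter.Tendsto (h⁻¹ : Equiv.Perm X) (nhds (h x)) (nhds x) := by
      refine (Filter.map_mono hle).trans ?_
      rw [Filter.map_map]
      have : ((h⁻¹ : Equiv.Perm X) : X → X) ∘ h = id := by ext z; simp
      rw [this, Filter.map_id]
    simpa [ContinuousAt] using this

/-- The group of all finitely supported permutations of `[0,1[`. -/
def Sfin : Subgroup (Equiv.Perm X) where
  carrier := {σ | {x | σ x ≠ x}.Finite}
  one_mem' := by simp
  mul_mem' := by
    intro f g hf hg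
    refine (Set.Finite.union hg hf).subset ?_
    intro x hx
    by_contra hcon
    simp only [Set.mem_union, Set.mem_ofPred_eq, not_or, not_not] at hcon
    exact hx (by simp [hcon.1, hcon.2])
  inv_mem' := by
    intro f hf
    refine Set.Finite.subset hf ?_
    intro x hx hfx
    exact hx (by rw [Equiv.Perm.inv_eq_iff_eq]; exact hfx.symm)

instance Sfin_normal : Sfin.Normal where
  conj_mem := by
    intro σ hσ g
    refine (Set.Finite.image g hσ).subset ?_
    intro x hx
    refine ⟨g⁻¹ x, fun h => hx ?_, by simp⟩
    rw [Equiv.Perm.mul_apply, Equiv.Perm.mul_apply, h]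
    simp

theorem Sfin_le_PChat : Sfin ≤ PChat := by
  intro σ hσ
  refine Set.Finite.subset hσ ?_
  intro x hx hfx
  apply hx
  have : (σ : X → X) =ᶠ[nhds x] id := by
    filter_upwards [nhds_cofinite hσ (fun h => h hfx)] with y hy
    by_contra hy'
    exact hy hy'
  exact continuousAt_id.congr this.symm

/-- The group of finitely supported permutations, inside the group of piecewise continuous
bijections. -/
abbrev SfinPC : Subgroup PChat := Sfin.subgroupOf PChat

/-- The quotient group `PC^⋈` of the piecewise continuous bijections by the finitely supported
permutations. -/
abbrev PCquot : Type := PChat ⧸ SfinPC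

/-! ### The classical signature on finitely supported permutations -/

/-- The sign of a finitely supported permutation: the sign of the permutation that it induces on
its (finite) support. -/
noncomputable def supportSign (σ : Sfin) : ℤˣ :=
  letI : Fintype {x : X // σ.1 x ≠ x} := Set.Finite.fintype σ.2
  Equiv.Perm.sign (σ.1.subtypePerm (p := fun x => σ.1 x ≠ x) (by simp))

/-- The sign can be computed on any finite invariant set containing the support. -/
theorem supportSign_eq (σ : Sfin) (p : X → Prop) [Fintype {x // p x}] [DecidableEq {x // p x}]
    (hp : ∀ x, p (σ.1 x) ↔ p x) (hs : ∀ x, σ.1 x ≠ x → p x) :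
    supportSign σ = Equiv.Perm.sign (σ.1.subtypePerm hp) := by
  let _ : Fintype {x : X // σ.1 x ≠ x} := Set.Finite.fintype σ.2
  refine Equiv.Perm.sign_bij (fun x _ => ⟨x.1, hs x.1 x.2⟩) ?_ ?_ ?_
  · intro x hx hx'
    rfl
  · intro x y _ _ hxy
    exact Subtype.ext (congrArg (fun z : {x // p x} => z.1) hxy)
  · intro y hy
    have hy' : σ.1 y.1 ≠ y.1 := fun h => hy (Subtype.ext h)
    refine ⟨⟨y.1, hy'⟩, fun h => hy' ?_, rfl⟩
    exact congrArg (fun z : {x : X // σ.1 x ≠ x} => z.1) h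

/-- The classical signature on finitely supported permutations, as a homomorphism to `{1, -1}`. -/
noncomputable def finSign : Sfin →* ℤˣ where
  toFun := supportSign
  map_one' := by
    classical
    let _ : Fintype {x : X // False} := ⟨∅, fun x => x.2.elim⟩
    rw [supportSign_eq 1 (fun _ => False) (by simp) (by simp)]
    exact Equiv.Perm.sign_one
  map_mul' := by
    classical
    intro σ τ
    let _ : Fintype {x : X // σ.1 x ≠ x ∨ τ.1 x ≠ x} :=
      Set.Finite.fintype (Set.Finite.union σ.2 τ.2)
    have inv : ∀ ρ : Equiv.Perm X, ∀ q : X → Prop, (∀ x, ρ x ≠ x → q x) →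
        ∀ x, q (ρ x) ↔ q x := by
      intro ρ q hq x
      by_cases hx : ρ x = x
      · rw [hx]
      · exact ⟨fun _ => hq x hx, fun _ => hq _ (fun h => hx (ρ.injective h))⟩
    have hσ : ∀ x, σ.1 x ≠ x → σ.1 x ≠ x ∨ τ.1 x ≠ x := fun x h => Or.inl h
    have hτ : ∀ x, τ.1 x ≠ x → σ.1 x ≠ x ∨ τ.1 x ≠ x := fun x h => Or.inr h
    have hστ : ∀ x, (σ * τ).1 x ≠ x → σ.1 x ≠ x ∨ τ.1 x ≠ x := by
      intro x h
      by_contra hcon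
      push Not at hcon
      exact h (by simp [hcon.1, hcon.2])
    have iσ := inv σ.1 _ hσ
    have iτ := inv τ.1 _ hτ
    have iστ := inv (σ * τ).1 _ hστ
    rw [supportSign_eq σ _ iσ hσ, supportSign_eq τ _ iτ hτ, supportSign_eq (σ * τ) _ iστ hστ,
      ← Equiv.Perm.sign_mul]
    congr 1

/-- The alternating group: finitely supported permutations of signature `1`. -/
noncomputable def Afin : Subgroup (Equiv.Perm X) := finSign.ker.map Sfin.subtype

/-- The alternating group, inside the group of piecewise continuous bijections. -/
noncomputable abbrev AfinPC : Subgroup PChat := Afin.subgroupOf PChat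

/-- The identification of `{1, -1}` with `ℤ/2ℤ`. -/
def parity (u : ℤˣ) : ZMod 2 := if u = 1 then 0 else 1

/-- The classical signature on finitely supported permutations, with values in `ℤ/2ℤ`. -/
noncomputable def epsFin (σ : Sfin) : ZMod 2 := parity (finSign σ)

/-! ### Partitions into intervals -/

/-- A finite partition of `[0,1[` into right-open and left-closed intervals is given by the finite
set `P ∋ 0` of the left endpoints of its intervals; `cell P a` is then the interior `]a, b[` of the
interval `[a, b[` with left endpoint `a ∈ P` (`b` being the next point of `P`, or `1`). -/
def cell (P : Finset X) (a : X) : Set X := {x | a < x ∧ ∀ p ∈ P, a < p → x < p}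

/-- A finite partition of `[0,1[` into right-open and left-closed intervals, such that `h` is
continuous on the interior of every interval. -/
structure AssocPartition (h : Equiv.Perm X) where
  /-- the set of left endpoints of the intervals -/
  leftEnds : Finset X
  zero_mem : 0 ∈ leftEnds
  cont : ∀ a ∈ leftEnds, ContinuousOn h (cell leftEnds a)

/-- The left endpoint of a nonempty interval contained in `[0,1[`. -/
noncomputable def leftEndpoint (S : Set X) : X :=
  ⟨sInf ((fun x : X => (x : ℝ)) '' S), by
    rcases S.eq_empty_or_nonempty with rfl | ⟨x, hx⟩
    · simp
    · have hb : ∀ y ∈ (fun x : X => (x : ℝ)) '' S, (0 : ℝ) ≤ y := by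
        rintro _ ⟨y, _, rfl⟩
        exact y.2.1
      exact ⟨Real.sInf_nonneg hb, (csInf_le ⟨0, hb⟩ ⟨x, hx, rfl⟩).trans_lt x.2.2⟩⟩

theorem leftEndpoint_le {S : Set X} {x : X} (hx : x ∈ S) : leftEndpoint S ≤ x := by
  have hb : ∀ y ∈ (fun x : X => (x : ℝ)) '' S, (0 : ℝ) ≤ y := by
    rintro _ ⟨y, _, rfl⟩
    exact y.2.1
  exact csInf_le (a := (x : ℝ)) ⟨0, hb⟩ ⟨x, hx, rfl⟩

theorem exists_lt_of_leftEndpoint_lt {S : Set X} (hS : S.Nonempty) {x : X}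
    (hx : leftEndpoint S < x) : ∃ y ∈ S, y < x := by
  obtain ⟨_, ⟨y, hy, rfl⟩, hyx⟩ :=
    exists_lt_of_csInf_lt (hS.image (fun x : X => (x : ℝ)))
      (show sInf ((fun x : X => (x : ℝ)) '' S) < (x : ℝ) from hx)
  exact ⟨y, hy, hyx⟩

theorem cell_subset_compl {P : Finset X} {a x : X} (hx : x ∈ cell P a) : x ∉ P :=
  fun h => lt_irrefl x (hx.2 x h hx.1)

theorem exists_cell {P : Finset X} (h0 : 0 ∈ P) {x : X} (hx : x ∉ P) :
    ∃ a ∈ P, x ∈ cell P a := by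
  have hpos : (0 : X) < x :=
    lt_of_le_of_ne (by exact_mod_cast x.2.1) (fun h => hx (h ▸ h0))
  obtain ⟨a, ha, hmax⟩ := (P.filter (· < x)).exists_max_image id
    ⟨0, Finset.mem_filter.2 ⟨h0, hpos⟩⟩
  rw [Finset.mem_filter] at ha
  refine ⟨a, ha.1, ha.2, fun p hp hap => ?_⟩
  by_contra hcon
  have hpx : p < x := lt_of_le_of_ne (not_lt.1 hcon) (fun h => hx (h ▸ hp))
  exact absurd (hmax p (Finset.mem_filter.2 ⟨hp, hpx⟩)) (not_le.2 hap)

theorem cell_unique {P : Finset X} {a b x : X} (ha : a ∈ P) (hb : b ∈ P) (hxa : x ∈ cell P a)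
    (hxb : x ∈ cell P b) : a = b := by
  rcases lt_trichotomy a b with h | h | h
  · exact absurd (hxa.2 b hb h) (not_lt.2 hxb.1.le)
  · exact h
  · exact absurd (hxb.2 a ha h) (not_lt.2 hxa.1.le)

theorem cell_isOpen (P : Finset X) (a : X) : IsOpen (cell P a) := by
  have : cell P a = Set.Ioi a ∩ ⋂ p ∈ P.filter (a < ·), Set.Iio p := by
    ext x
    simp [cell]
  rw [this]
  exact isOpen_Ioi.inter (isOpen_biInter_finset fun p _ => isOpen_Iio)

theorem cell_ordConnected (P : Finset X) (a : X) : (cell P a).OrdConnected :=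
  ⟨fun _ hx _ hy _ hz => ⟨hx.1.trans_le hz.1, fun p hp hap => hz.2.trans_lt (hy.2 p hp hap)⟩⟩

theorem cell_nonempty (P : Finset X) (a : X) : (cell P a).Nonempty := by
  by_cases hP : (P.filter (a < ·)).Nonempty
  · obtain ⟨b, hb, hmin⟩ := (P.filter (a < ·)).exists_min_image id hP
    obtain ⟨x, hax, hxb⟩ := exists_between (Finset.mem_filter.1 hb).2
    exact ⟨x, hax, fun p hp hap => hxb.trans_le (hmin p (Finset.mem_filter.2 ⟨hp, hap⟩))⟩
  · obtain ⟨u, hu1, hu2⟩ := exists_between a.2.2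
    exact ⟨⟨u, a.2.1.trans hu1.le, hu2⟩, hu1,
      fun p hp hap => (hP ⟨p, Finset.mem_filter.2 ⟨hp, hap⟩⟩).elim⟩

section image

variable {h : Equiv.Perm X} (P : AssocPartition h)

theorem image_cell_nonempty (a : X) : (h '' cell P.leftEnds a).Nonempty :=
  (cell_nonempty _ a).image h

theorem eventually_continuousAt {a x : X} (ha : a ∈ P.leftEnds) (hx : x ∈ cell P.leftEnds a) :
    ∀ᶠ y in nhds x, ContinuousAt h y := by
  filter_upwards [(cell_isOpen P.leftEnds a).mem_nhds hx] with y hy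
  exact (P.cont a ha).continuousAt ((cell_isOpen P.leftEnds a).mem_nhds hy)

theorem ne_zero_of_mem_cell {a x : X} (hx : x ∈ cell P.leftEnds a) : x ≠ 0 :=
  fun h0 => cell_subset_compl hx (h0 ▸ P.zero_mem)

theorem image_cell_isOpen {a : X} (ha : a ∈ P.leftEnds) : IsOpen (h '' cell P.leftEnds a) := by
  rw [isOpen_iff_mem_nhds]
  rintro _ ⟨x, hx, rfl⟩
  refine nhds_le_map h.injective (ne_zero_of_mem_cell P hx) (eventually_continuousAt P ha hx) ?_
  rw [Filter.mem_map, Set.preimage_image_eq _ h.injective]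
  exact (cell_isOpen P.leftEnds a).mem_nhds hx

theorem image_cell_ordConnected {a : X} (ha : a ∈ P.leftEnds) :
    (h '' cell P.leftEnds a).OrdConnected := by
  have : Inhabited X := ⟨0⟩
  exact ((cell_ordConnected P.leftEnds a).isPreconnected.image h (P.cont a ha)).ordConnected

theorem eq_of_mem_image_cell {a b y : X} (ha : a ∈ P.leftEnds) (hb : b ∈ P.leftEnds)
    (hya : y ∈ h '' cell P.leftEnds a) (hyb : y ∈ h '' cell P.leftEnds b) : a = b := by
  obtain ⟨x, hx, rfl⟩ := hya
  obtain ⟨x', hx', he⟩ := hyb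
  rw [h.injective he] at hx'
  exact cell_unique ha hb hx hx'

/-- The left endpoint of `h(I°)`. -/
noncomputable def imageLeft (a : X) : X := leftEndpoint (h '' cell P.leftEnds a)

theorem imageLeft_notMem {a : X} (ha : a ∈ P.leftEnds) :
    imageLeft P a ∉ h '' cell P.leftEnds a := by
  rintro ⟨x, hx, hxe⟩
  obtain ⟨l, r, hlx, hxr, hI, -, hmono⟩ := exists_Icc_strictMonoOn h.injective
    (ne_zero_of_mem_cell P hx) (eventually_continuousAt P ha hx)
    ((cell_isOpen P.leftEnds a).mem_nhds hx)
  have hl : l ∈ Set.Icc l r := ⟨le_rfl, (hlx.trans hxr).le⟩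
  have hr : r ∈ Set.Icc l r := ⟨(hlx.trans hxr).le, le_rfl⟩
  have hxm : x ∈ Set.Icc l r := ⟨hlx.le, hxr.le⟩
  have key : ∀ z ∈ Set.Icc l r, ¬ h z < h x := fun z hz hlt =>
    absurd (leftEndpoint_le (Set.mem_image_of_mem h (hI hz))) (not_le.2 (hlt.trans_eq hxe))
  rcases hmono with hm | hm
  · exact key l hl (hm hl hxm hlx)
  · exact key r hr (hm hxm hr hxr)

/-- The left endpoints of the intervals `h(I°)` are images of left endpoints. -/
theorem inv_imageLeft_mem {a : X} (ha : a ∈ P.leftEnds) :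
    h⁻¹ (imageLeft P a) ∈ P.leftEnds := by
  by_contra hcon
  obtain ⟨b, hb, hxb⟩ := exists_cell P.zero_mem hcon
  have hmem : imageLeft P a ∈ h '' cell P.leftEnds b := ⟨_, hxb, by simp⟩
  have h1 : ∃ u : X, imageLeft P a < u := by
    obtain ⟨u, hu1, hu2⟩ := exists_between (imageLeft P a).2.2
    exact ⟨⟨u, (imageLeft P a).2.1.trans hu1.le, hu2⟩, hu1⟩
  obtain ⟨u, hu, hsub⟩ := exists_Ico_subset_of_mem_nhds
    ((image_cell_isOpen P hb).mem_nhds hmem) h1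
  obtain ⟨y, hy, hyu⟩ := exists_lt_of_leftEndpoint_lt (image_cell_nonempty P a) hu
  have hyb : y ∈ h '' cell P.leftEnds b := hsub ⟨leftEndpoint_le hy, hyu⟩
  have hab : a = b := eq_of_mem_image_cell P ha hb hy hyb
  subst hab
  exact imageLeft_notMem P ha hmem

theorem imageLeft_injOn {a b : X} (ha : a ∈ P.leftEnds) (hb : b ∈ P.leftEnds)
    (hab : imageLeft P a = imageLeft P b) : a = b := by
  obtain ⟨y, hy⟩ := image_cell_nonempty P a
  obtain ⟨z, hz⟩ := image_cell_nonempty P b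
  have hlt : ∀ {c w : X}, c ∈ P.leftEnds → w ∈ h '' cell P.leftEnds c → imageLeft P c < w :=
    fun hc hw => lt_of_le_of_ne (leftEndpoint_le hw) (fun he => imageLeft_notMem P hc (he ▸ hw))
  rcases le_total y z with hyz | hyz
  · obtain ⟨w, hw, hwy⟩ := exists_lt_of_leftEndpoint_lt (image_cell_nonempty P b)
      (show imageLeft P b < y from hab ▸ hlt ha hy)
    exact eq_of_mem_image_cell P ha hb hy
      ((image_cell_ordConnected P hb).out hw hz ⟨hwy.le, hyz⟩)
  · obtain ⟨w, hw, hwz⟩ := exists_lt_of_leftEndpoint_lt (image_cell_nonempty P a)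
      (show imageLeft P a < z from hab ▸ hlt hb hz)
    exact eq_of_mem_image_cell P ha hb ((image_cell_ordConnected P ha).out hw hy ⟨hwz.le, hyz⟩) hz

/-- The map sending `h(a)` to the left endpoint of `h(I°)`, for every interval `I` of the partition
with left endpoint `a`, and fixing all other points. -/
noncomputable def defaultFun (y : X) : X :=
  open Classical in if h⁻¹ y ∈ P.leftEnds then imageLeft P (h⁻¹ y) else y

theorem defaultFun_injective : Function.Injective (defaultFun P) := by
  intro y z hyz
  unfold defaultFun at hyz
  split_ifs at hyz with hy hz hz
  · exact h⁻¹.injective (imageLeft_injOn P hy hz hyz)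
  · exact absurd (hyz ▸ inv_imageLeft_mem P hy) hz
  · exact absurd (hyz ▸ inv_imageLeft_mem P hz) hy
  · exact hyz

theorem defaultFun_surjective : Function.Surjective (defaultFun P) := by
  classical
  intro y
  by_cases hy : h⁻¹ y ∈ P.leftEnds
  · have hinj : Set.InjOn (fun a => h⁻¹ (imageLeft P a)) P.leftEnds := fun a ha b hb hab =>
      imageLeft_injOn P ha hb (h⁻¹.injective hab)
    have himg : P.leftEnds.image (fun a => h⁻¹ (imageLeft P a)) = P.leftEnds :=
      Finset.eq_of_subset_of_card_le
        (fun x hx => by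
          obtain ⟨a, ha, rfl⟩ := Finset.mem_image.1 hx
          exact inv_imageLeft_mem P ha)
        (Finset.card_image_of_injOn hinj).ge
    rw [← himg] at hy
    obtain ⟨a, ha, hay⟩ := Finset.mem_image.1 hy
    refine ⟨h a, ?_⟩
    unfold defaultFun
    have hinv : h⁻¹ (h a) = a := by simp
    rw [hinv, if_pos ha]
    exact h⁻¹.injective hay
  · exact ⟨y, if_neg hy⟩

/-- The default of pseudo right continuity `σ_(h,P)`, a finitely supported permutation. -/
noncomputable def defaultPerm : Sfin :=
  ⟨Equiv.ofBijective (defaultFun P) ⟨defaultFun_injective P, defaultFun_surjective P⟩, by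
    classical
    refine (P.leftEnds.finite_toSet.image h).subset fun y hy => ?_
    by_contra hcon
    refine hy (if_neg fun hmem => hcon ⟨h⁻¹ y, hmem, by simp⟩)⟩

/-- The flip number `R(h,P)`: the number of intervals of the partition on (the interior of) which
`h` is order-reversing. -/
noncomputable def flipNumber : ℕ :=
  open Classical in (P.leftEnds.filter fun a => StrictAntiOn h (cell P.leftEnds a)).card

/-- The signature of `h` computed with the partition `P`. -/
noncomputable def epsOf : ZMod 2 := (flipNumber P : ZMod 2) + epsFin (defaultPerm P)

end image

/-- The minimal partition into intervals associated with `h`: the left endpoints are `0` and the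
points of discontinuity of `h`. -/
noncomputable def minPartition (h : PChat) : AssocPartition h.1 where
  leftEnds := open Classical in
    insert 0 (show {x | ¬ ContinuousAt h.1 x}.Finite from h.2).toFinset
  zero_mem := by simp
  cont := by
    intro a _ x hx
    refine ContinuousAt.continuousWithinAt ?_
    by_contra hcon
    refine cell_subset_compl hx ?_
    exact Finset.mem_insert_of_mem ((Set.Finite.mem_toFinset _).2 hcon)

/-- The partition `minPartition h` is coarser than every partition associated with `h`. -/
theorem minPartition_leftEnds_subset (h : PChat) (P : AssocPartition h.1) :
    (minPartition h).leftEnds ⊆ P.leftEnds := by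
  intro x hx
  rcases Finset.mem_insert.1 hx with rfl | hx
  · exact P.zero_mem
  · rw [Set.Finite.mem_toFinset] at hx
    by_contra hcon
    obtain ⟨a, ha, hxa⟩ := exists_cell P.zero_mem hcon
    exact hx ((P.cont a ha).continuousAt ((cell_isOpen _ _).mem_nhds hxa))

/-- The signature `ε` of a piecewise continuous bijection. -/
noncomputable def eps (h : PChat) : ZMod 2 := epsOf (minPartition h)

end PC

/-! The signature is additive because it need not be computed on the minimal partition. Cutting an
interval at an interior point changes nothing if `h` increases there. If `h` decreases, it adds one
flip and multiplies the default permutation by one transposition, and the two changes cancel modulo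
2 (`epsOf_refine_insert`). For a product `f * g` one may therefore use a partition for `g` whose
image under `g` is a partition for `f`. Flips then add interval by interval, and the default of `f *
g` is the default of `f` times the conjugate by `f` of the default of `g` (`epsOf_comp`).
Conjugation preserves the classical sign, so `eps_mul` follows. On finitely supported permutations
the default is the inverse permutation, so the signature extends the classical one
(`eps_of_mem_Sfin`).

For the normal subgroups, commutators with transpositions turn any nontrivial element into a 3-cycle
without leaving the subgroup. Hence every nontrivial normal subgroup contains the alternating group
(`Afin_le_of_normalized`). What remains is formal (`normal_subgroups_of_simple_quotient`). A normal
subgroup maps trivially or onto the simple quotient, and it does or does not contain an odd finitely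
supported permutation; these alternatives give the four nontrivial subgroups. Noncommutativity of
the quotient supplies even elements outside the kernel, because commutators are even. -/

/-! ### Group theory: normal subgroups over a simple quotient -/

/-- A surjection onto a nonabelian simple group together with a sign that is nontrivial on its
kernel: if every nontrivial normal subgroup contains the even part of the kernel, then there are
exactly five normal subgroups. -/
theorem normal_subgroups_of_simple_quotient {H G : Type*} [Group H] [Group G] [IsSimpleGroup G]
    (π : H →* G) (hπ : Function.Surjective π) (hG : ∃ a b : G, a * b ≠ b * a)
    {Z : Type*} [CommGroup Z] (ε : H →* Z) (hZ : ∀ s t : H, ε s ≠ 1 → ε t ≠ 1 → ε s = ε t)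
    {A : Subgroup H} (hA : A = π.ker ⊓ ε.ker) (hA0 : A ≠ ⊥) (hS : ¬ π.ker ≤ ε.ker)
    (hmin : ∀ N : Subgroup H, N.Normal → N ≠ ⊥ → A ≤ N) :
    {N : Subgroup H | N.Normal} = {⊥, A, π.ker, ε.ker, ⊤} ∧
      {N : Subgroup H | N.Normal}.ncard = 5 := by
  obtain ⟨a, b, hab⟩ := hG
  obtain ⟨s, hsπ, hsε⟩ := SetLike.not_le_iff_exists.1 hS
  rw [MonoidHom.mem_ker] at hsπ hsε
  -- a normal subgroup maps to `1` or onto `G`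
  have dich : ∀ N : Subgroup H, N.Normal → N ≤ π.ker ∨ ∀ h : H, ∃ n ∈ N, π n = π h := by
    intro N hN
    have : (N.map π).Normal := hN.map π hπ
    rcases this.eq_bot_or_eq_top with h | h
    · exact Or.inl ((Subgroup.map_eq_bot_iff N).1 h)
    · refine Or.inr fun x => ?_
      have : π x ∈ N.map π := h ▸ Subgroup.mem_top _
      exact this
  -- a subgroup mapping onto `G` contains an element of `ker ε` outside `ker π`
  have comm : ∀ N : Subgroup H, (∀ h : H, ∃ n ∈ N, π n = π h) → ¬ N ⊓ ε.ker ≤ π.ker := by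
    intro N hN hle
    obtain ⟨x, hx⟩ := hπ a
    obtain ⟨y, hy⟩ := hπ b
    obtain ⟨n, hn, hnx⟩ := hN x
    obtain ⟨m, hm, hmy⟩ := hN y
    -- The commutator has trivial sign because `Z` is commutative, while its image in `G` is the
    -- commutator of `a` and `b`, which is nontrivial.
    have h1 : n * m * n⁻¹ * m⁻¹ ∈ N ⊓ ε.ker := by
      refine ⟨N.mul_mem (N.mul_mem (N.mul_mem hn hm) (N.inv_mem hn)) (N.inv_mem hm), ?_⟩
      simp [mul_comm (ε n) (ε m)]
    have h2 := hle h1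
    rw [MonoidHom.mem_ker, map_mul, map_mul, map_mul, map_inv, map_inv, hnx, hmy, hx, hy] at h2
    exact hab (by rw [mul_inv_eq_one, mul_inv_eq_iff_eq_mul] at h2; exact h2)
  have htop : ¬ (⊤ : Subgroup H) ⊓ ε.ker ≤ π.ker := comm ⊤ fun h => ⟨h, trivial, rfl⟩
  have hεπ : ¬ ε.ker ≤ π.ker := by rwa [top_inf_eq] at htop
  have hAπ : A ≤ π.ker := hA ▸ inf_le_left
  have hAε : A ≤ ε.ker := hA ▸ inf_le_right
  have key : ∀ N : Subgroup H, N.Normal → N = ⊥ ∨ N = A ∨ N = π.ker ∨ N = ε.ker ∨ N = ⊤ := by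
    intro N hN
    rcases eq_or_ne N ⊥ with h0 | h0
    · exact Or.inl h0
    have hAN := hmin N hN h0
    -- Any two odd elements of `π.ker` differ by an element of `A`, so a single one, together with
    -- `A`, yields all of `π.ker`.
    have hsN : (∃ t ∈ N, π t = 1 ∧ ε t ≠ 1) → π.ker ≤ N := by
      rintro ⟨t, ht, htπ, htε⟩ k hk
      rw [MonoidHom.mem_ker] at hk
      by_cases hkε : ε k = 1
      · exact hAN (hA ▸ ⟨hk, hkε⟩)
      · have h1 : k * t⁻¹ ∈ A := by
          rw [hA]
          refine ⟨?_, ?_⟩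
          · simp [hk, htπ]
          · simp [hZ k t hkε htε]
        have := N.mul_mem (hAN h1) ht
        rwa [inv_mul_cancel_right] at this
    have hNA : ¬ (∃ t ∈ N, π t = 1 ∧ ε t ≠ 1) → N ⊓ π.ker ≤ A := by
      intro hcon t ht
      rw [hA]
      refine ⟨ht.2, ?_⟩
      by_contra h
      exact hcon ⟨t, ht.1, ht.2, h⟩
    rcases dich N hN with hle | hfull
    · by_cases hcon : ∃ t ∈ N, π t = 1 ∧ ε t ≠ 1
      · exact Or.inr (Or.inr (Or.inl (le_antisymm hle (hsN hcon))))
      · exact Or.inr (Or.inl (le_antisymm (fun t ht => hNA hcon ⟨ht, hle ht⟩) hAN))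
    · by_cases hcon : ∃ t ∈ N, π t = 1 ∧ ε t ≠ 1
      · refine Or.inr (Or.inr (Or.inr (Or.inr (eq_top_iff.2 fun x _ => ?_))))
        obtain ⟨n, hn, hnx⟩ := hfull x
        have h1 : n⁻¹ * x ∈ N := hsN hcon (by simp [MonoidHom.mem_ker, hnx])
        have := N.mul_mem hn h1
        rwa [mul_inv_cancel_left] at this
      -- Here `N` maps onto `G` and meets `π.ker` only in even elements. Its even part is again
      -- normal and not inside `π.ker`, so it also maps onto `G`. Comparing elements with the same
      -- image in `G` modulo `A` gives both inclusions between `N` and `ε.ker`.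
      · have hM : (N ⊓ ε.ker).Normal := inferInstance
        have hMfull := (dich _ hM).resolve_left (comm N hfull)
        have hNε : N ≤ ε.ker := by
          intro n hn
          obtain ⟨m, hm, hmn⟩ := hMfull n
          have h1 : m⁻¹ * n ∈ A :=
            hNA hcon ⟨N.mul_mem (N.inv_mem hm.1) hn, by simp [hmn]⟩
          have := ε.ker.mul_mem hm.2 (hAε h1)
          rwa [mul_inv_cancel_left] at this
        refine Or.inr (Or.inr (Or.inr (Or.inl (le_antisymm hNε fun k hk => ?_))))
        obtain ⟨m, hm, hmk⟩ := hMfull k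
        have h1 : m⁻¹ * k ∈ A := by
          rw [hA]
          exact ⟨by simp [hmk], ε.ker.mul_mem (ε.ker.inv_mem hm.2) hk⟩
        have := N.mul_mem hm.1 (hAN h1)
        rwa [mul_inv_cancel_left] at this
  have heq : {N : Subgroup H | N.Normal} = {⊥, A, π.ker, ε.ker, ⊤} := by
    ext N
    simp only [Set.mem_ofPred_eq, Set.mem_insert_iff, Set.mem_singleton_iff]
    refine ⟨key N, ?_⟩
    rintro (rfl | rfl | rfl | rfl | rfl)
    · infer_instance
    · rw [hA]; infer_instance
    · infer_instance
    · infer_instance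
    · infer_instance
  refine ⟨heq, ?_⟩
  rw [heq]
  have hsA : s ∉ A := fun h => hsε (hAε h)
  have e1 : A ≠ π.ker := fun h => hsA (h ▸ hsπ)
  have e2 : A ≠ ε.ker := fun h => hεπ (h ▸ hAπ)
  have e3 : A ≠ ⊤ := fun h => hsA (h ▸ Subgroup.mem_top s)
  have e4 : π.ker ≠ ε.ker := fun h => hεπ h.ge
  have e5 : π.ker ≠ ⊤ := fun h => hεπ (h ▸ le_top)
  have e6 : ε.ker ≠ ⊤ := fun h => hS (h ▸ le_top)
  have b1 : π.ker ≠ ⊥ := fun h => hA0 (le_bot_iff.1 (h ▸ hAπ))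
  have b2 : ε.ker ≠ ⊥ := fun h => hA0 (le_bot_iff.1 (h ▸ hAε))
  have b3 : (⊤ : Subgroup H) ≠ ⊥ := fun h => hA0 (le_bot_iff.1 (h ▸ le_top))
  rw [Set.ncard_insert_of_notMem (by simp [hA0.symm, b1.symm, b2.symm, b3.symm]),
    Set.ncard_insert_of_notMem (by simp [e1, e2, e3]),
    Set.ncard_insert_of_notMem (by simp [e4, e5]), Set.ncard_pair e6]

namespace PC

/-! ### The signature of finitely supported permutations -/

theorem parity_mul : ∀ u v : ℤˣ, parity (u * v) = parity u + parity v := by decide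

theorem parity_eq_zero : ∀ u : ℤˣ, parity u = 0 ↔ u = 1 := by decide

theorem epsFin_mul (σ τ : Sfin) : epsFin (σ * τ) = epsFin σ + epsFin τ := by
  simp [epsFin, parity_mul]

theorem epsFin_inv (σ : Sfin) : epsFin σ⁻¹ = epsFin σ := by
  simp [epsFin]

theorem epsFin_eq_zero_iff (σ : Sfin) : epsFin σ = 0 ↔ finSign σ = 1 := parity_eq_zero _

theorem swap_mem_Sfin (a b : X) : Equiv.swap a b ∈ Sfin := by
  refine (Set.toFinite {a, b}).subset fun x hx => ?_
  by_contra hcon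
  simp only [Set.mem_insert_iff, Set.mem_singleton_iff, not_or] at hcon
  exact hx (Equiv.swap_apply_of_ne_of_ne hcon.1 hcon.2)

/-- The transposition of `a` and `b`. -/
noncomputable def finSwap (a b : X) : Sfin := ⟨Equiv.swap a b, swap_mem_Sfin a b⟩

theorem finSign_finSwap {a b : X} (hab : a ≠ b) : finSign (finSwap a b) = -1 := by
  classical
  let _ : Fintype {x : X // x = a ∨ x = b} := Set.Finite.fintype (Set.toFinite ({a, b} : Set X))
  have hs : ∀ x, (finSwap a b).1 x ≠ x → x = a ∨ x = b := by
    intro x hx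
    by_contra hcon
    rw [not_or] at hcon
    exact hx (Equiv.swap_apply_of_ne_of_ne hcon.1 hcon.2)
  have hp : ∀ x, ((finSwap a b).1 x = a ∨ (finSwap a b).1 x = b) ↔ (x = a ∨ x = b) := by
    intro x
    change (Equiv.swap a b x = a ∨ Equiv.swap a b x = b) ↔ _
    rw [Equiv.swap_apply_eq_iff, Equiv.swap_apply_eq_iff, Equiv.swap_apply_left,
      Equiv.swap_apply_right, or_comm]
  change supportSign (finSwap a b) = -1
  rw [supportSign_eq _ _ hp hs]
  have : (finSwap a b).1.subtypePerm hp = 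
      Equiv.swap (⟨a, Or.inl rfl⟩ : {x : X // x = a ∨ x = b}) ⟨b, Or.inr rfl⟩ := by
    ext x
    change ((Equiv.swap a b x.1 : X) : ℝ) = _
    rcases x with ⟨x, rfl | rfl⟩ <;> simp
  rw [this, Equiv.Perm.sign_swap (by simpa using hab)]

theorem epsFin_finSwap {a b : X} (hab : a ≠ b) : epsFin (finSwap a b) = 1 := by
  rw [epsFin, finSign_finSwap hab]
  decide

/-- The signature is invariant under conjugation by arbitrary permutations. -/
theorem finSign_conj (f : Equiv.Perm X) (σ : Sfin) (τ : Sfin) (h : τ.1 = f * σ.1 * f⁻¹) :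
    finSign τ = finSign σ := by
  classical
  let _ : Fintype {x : X // σ.1 x ≠ x} := Set.Finite.fintype σ.2
  let _ : Fintype {x : X // τ.1 x ≠ x} := Set.Finite.fintype τ.2
  have hc : ∀ x, τ.1 (f x) = f (σ.1 x) := fun x => by rw [h]; simp
  symm
  refine Equiv.Perm.sign_bij (fun x _ => ⟨f x.1, fun hx => x.2 ?_⟩) ?_ ?_ ?_
  · rw [hc] at hx
    exact f.injective hx
  · intro x hx hx'
    exact Subtype.ext (hc x.1).symm
  · intro x y _ _ hxy
    exact Subtype.ext (f.injective (congrArg (fun z : {x : X // τ.1 x ≠ x} => z.1) hxy))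
  · rintro ⟨y, hy⟩ hy'
    obtain ⟨x, rfl⟩ := f.surjective y
    have hx : σ.1 x ≠ x := fun hx => hy (by rw [hc, hx])
    exact ⟨⟨x, hx⟩, fun h => hx (congrArg (fun z : {x : X // σ.1 x ≠ x} => z.1) h), rfl⟩

theorem epsFin_conj (f : Equiv.Perm X) (σ : Sfin) (τ : Sfin) (h : τ.1 = f * σ.1 * f⁻¹) :
    epsFin τ = epsFin σ := by
  rw [epsFin, epsFin, finSign_conj f σ τ h]

/-- Induction on finitely supported permutations as products of transpositions. -/
theorem Sfin_induction {p : Sfin → Prop} (one : p 1)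
    (swap_mul : ∀ a b σ, a ≠ b → p σ → p (finSwap a b * σ)) (σ : Sfin) : p σ := by
  classical
  have hσ : σ.1 ∈ Subgroup.closure {τ : Equiv.Perm X | τ.IsSwap} := by
    rw [_root_.mem_closure_isSwap']
    exact σ.2
  have key : ∀ τ ∈ Subgroup.closure {τ : Equiv.Perm X | τ.IsSwap},
      ∀ h : τ ∈ Sfin, p ⟨τ, h⟩ := by
    intro τ hτ
    induction hτ using Subgroup.closure_induction_left with
    | one => exact fun _ => one
    | mul_left x hx y _ ih =>
      intro h
      obtain ⟨a, b, hab, rfl⟩ := hx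
      have hy : y ∈ Sfin := by
        have := Sfin.mul_mem (swap_mem_Sfin a b) h
        rwa [show Equiv.swap a b * (Equiv.swap a b * y) = y by simp] at this
      exact swap_mul a b ⟨y, hy⟩ hab (ih hy)
    | inv_mul_cancel x hx y _ ih =>
      intro h
      obtain ⟨a, b, hab, rfl⟩ := hx
      -- The left factor is an inverted generator; naming it `s` lets `subst` replace it by the
      -- transposition itself.
      have hab' := Equiv.swap_inv a b
      generalize (Equiv.swap a b)⁻¹ = s at *
      subst hab'
      have hy : y ∈ Sfin := by
        have := Sfin.mul_mem (swap_mem_Sfin a b) h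
        rwa [show Equiv.swap a b * (Equiv.swap a b * y) = y by simp] at this
      exact swap_mul a b ⟨y, hy⟩ hab (ih hy)
  exact key σ.1 hσ σ.2

/-! ### The alternating group lies in every nontrivial normalized subgroup -/

theorem conj_swap (g : Equiv.Perm X) (x y : X) :
    g * Equiv.swap x y * g⁻¹ = Equiv.swap (g x) (g y) :=
  (Equiv.swap_apply_apply g x y).symm

theorem exists_notMem_finset (s : Finset X) : ∃ x, x ∉ s := Infinite.exists_notMem_finset s

/-- A subgroup normalized by the transpositions that contains one 3-cycle identifies all
transpositions. -/
theorem swap_mul_swap_mem {N : Subgroup (Equiv.Perm X)}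
    (hN : ∀ n ∈ N, ∀ a b, Equiv.swap a b * n * (Equiv.swap a b)⁻¹ ∈ N) {x z e : X} (hxz : x ≠ z)
    (hxe : x ≠ e) (hze : z ≠ e) (h : Equiv.swap x e * Equiv.swap z e ∈ N) {a b c d : X}
    (hab : a ≠ b) (hcd : c ≠ d) : Equiv.swap a b * Equiv.swap c d ∈ N := by
  -- Conjugation by a transposition relabels the points. With `trans`, `symm` and `refl`, "the
  -- product lies in `N`" is an equivalence relation on transpositions, and the goal is that it has
  -- one class.
  have conj : ∀ {p q r s : X} (u v : X), Equiv.swap p q * Equiv.swap r s ∈ N →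
      Equiv.swap (Equiv.swap u v p) (Equiv.swap u v q) *
        Equiv.swap (Equiv.swap u v r) (Equiv.swap u v s) ∈ N := by
    intro p q r s u v hm
    have := hN _ hm u v
    rw [← conj_swap, ← conj_swap]
    simpa [mul_assoc] using this
  have trans : ∀ {p q r s t u : X}, Equiv.swap p q * Equiv.swap r s ∈ N →
      Equiv.swap r s * Equiv.swap t u ∈ N → Equiv.swap p q * Equiv.swap t u ∈ N := by
    intro p q r s t u h1 h2
    have := N.mul_mem h1 h2
    rwa [show Equiv.swap p q * Equiv.swap r s * (Equiv.swap r s * Equiv.swap t u) =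
      Equiv.swap p q * Equiv.swap t u by rw [mul_assoc]; simp] at this
  have symm : ∀ {p q r s : X}, Equiv.swap p q * Equiv.swap r s ∈ N →
      Equiv.swap r s * Equiv.swap p q ∈ N := by
    intro p q r s h1
    simpa using N.inv_mem h1
  have refl : ∀ {p q : X}, Equiv.swap p q * Equiv.swap p q ∈ N := by
    intro p q
    simp
  have base : ∀ p, p ≠ e → Equiv.swap x e * Equiv.swap p e ∈ N := by
    intro p hp
    by_cases hpx : p = x
    · subst hpx; exact refl
    · have := conj z p h
      rwa [Equiv.swap_apply_of_ne_of_ne hxz (Ne.symm hpx),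
        Equiv.swap_apply_of_ne_of_ne (Ne.symm hze) (Ne.symm hp), Equiv.swap_apply_left] at this
  have all : ∀ p q, p ≠ q → Equiv.swap x e * Equiv.swap p q ∈ N := by
    intro p q hpq
    by_cases hq : q = e
    · subst hq; exact base p hpq
    by_cases hp : p = e
    · subst hp; rw [Equiv.swap_comm p q]; exact base q hq
    -- The transpositions `(q e)` and `(p e)` are already equivalent; exchanging `q` and `e` makes
    -- `(q e)` equivalent to `(p q)`.
    have h1 := conj q e (trans (symm (base q hq)) (base p hp))
    rw [Equiv.swap_apply_left, Equiv.swap_apply_right, Equiv.swap_apply_of_ne_of_ne hpq hp,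
      Equiv.swap_comm e q] at h1
    exact trans (base q hq) h1
  exact trans (symm (all a b hab)) (all c d hcd)

/-- A nontrivial subgroup normalized by the transpositions contains the alternating group. -/
theorem Afin_le_of_normalized {N : Subgroup (Equiv.Perm X)}
    (hN : ∀ n ∈ N, ∀ a b, Equiv.swap a b * n * (Equiv.swap a b)⁻¹ ∈ N) (h0 : N ≠ ⊥) :
    Afin ≤ N := by
  classical
  obtain ⟨g, hg, hg1⟩ := N.bot_or_exists_ne_one.resolve_left h0
  obtain ⟨x, hx⟩ : ∃ x, g x ≠ x := by
    by_contra! hcon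
    exact hg1 (Equiv.ext hcon)
  -- With these choices the commutator of `g` with the transposition `(x z)` sends `z` to `x` and
  -- fixes `e`. A second commutator, with `(z e)`, is then `(x e)(z e)`, a 3-cycle.
  obtain ⟨z, hz⟩ := exists_notMem_finset {x, g⁻¹ x}
  obtain ⟨e, he⟩ := exists_notMem_finset {x, z, g x, g z}
  simp only [Finset.mem_insert, Finset.mem_singleton, not_or] at hz he
  have hgz : g z ≠ x := fun h => hz.2 (by rw [← h]; simp)
  -- the commutator with a transposition
  have comm : ∀ n ∈ N, ∀ p q, Equiv.swap (n p) (n q) * Equiv.swap p q ∈ N := by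
    intro n hn p q
    have := N.mul_mem hn (hN _ (N.inv_mem hn) p q)
    rw [← conj_swap]
    simpa [mul_assoc] using this
  have h1 := comm _ (comm g hg x z) z e
  have hz' : (Equiv.swap (g x) (g z) * Equiv.swap x z) z = x := by
    rw [Equiv.Perm.mul_apply, Equiv.swap_apply_right,
      Equiv.swap_apply_of_ne_of_ne (Ne.symm hx) (Ne.symm hgz)]
  have he' : (Equiv.swap (g x) (g z) * Equiv.swap x z) e = e := by
    rw [Equiv.Perm.mul_apply, Equiv.swap_apply_of_ne_of_ne he.1 he.2.1,
      Equiv.swap_apply_of_ne_of_ne he.2.2.1 he.2.2.2]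
  rw [hz', he'] at h1
  have hsw : ∀ {a b c d : X}, a ≠ b → c ≠ d → Equiv.swap a b * Equiv.swap c d ∈ N :=
    fun hab hcd => swap_mul_swap_mem hN (Ne.symm hz.1) (Ne.symm he.1) (Ne.symm he.2.1) h1 hab hcd
  -- an element of `Sfin` is in `N` or in the coset of a transposition, according to its sign
  have key : ∀ σ : Sfin, (finSign σ = 1 → σ.1 ∈ N) ∧
      (finSign σ = -1 → ∀ a b, a ≠ b → Equiv.swap a b * σ.1 ∈ N) := by
    intro σ
    induction σ using Sfin_induction with
    | one =>
      refine ⟨fun _ => N.one_mem, fun h => ?_⟩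
      rw [map_one] at h
      exact absurd h (by decide)
    | swap_mul a b σ hab ih =>
      rw [map_mul, finSign_finSwap hab]
      refine ⟨fun h => ih.2 ?_ a b hab, fun h c d hcd => ?_⟩
      · simpa using congrArg Neg.neg h
      · have h2 := N.mul_mem (hsw hcd hab) (ih.1 (by simpa using h))
        rwa [mul_assoc] at h2
  rintro _ ⟨σ, hσ, rfl⟩
  exact (key σ).1 hσ

theorem Afin_ne_bot : Afin ≠ ⊥ := by
  obtain ⟨x, -⟩ := exists_notMem_finset ∅
  obtain ⟨z, hz⟩ := exists_notMem_finset {x}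
  obtain ⟨e, he⟩ := exists_notMem_finset {x, z}
  simp only [Finset.mem_insert, Finset.mem_singleton, not_or] at hz he
  intro h
  have hm : (finSwap x z * finSwap x e).1 ∈ Afin := by
    refine ⟨finSwap x z * finSwap x e, ?_, rfl⟩
    simp [MonoidHom.mem_ker, finSign_finSwap (Ne.symm hz), finSign_finSwap (Ne.symm he.1)]
  rw [h, Subgroup.mem_bot] at hm
  have h1 := congrArg (fun f : Equiv.Perm X => f x) hm
  change Equiv.swap x z (Equiv.swap x e x) = x at h1
  rw [Equiv.swap_apply_left, Equiv.swap_apply_of_ne_of_ne he.1 he.2] at h1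
  exact he.1 h1

/-! ### Independence of the partition -/

theorem isGLB_leftEndpoint {S : Set X} (hS : S.Nonempty) : IsGLB S (leftEndpoint S) := by
  refine ⟨fun x hx => leftEndpoint_le hx, fun m hm => ?_⟩
  by_contra hcon
  obtain ⟨y, hy, hym⟩ := exists_lt_of_leftEndpoint_lt hS (not_le.1 hcon)
  exact absurd (hm hy) (not_le.2 hym)

theorem leftEndpoint_eq {S : Set X} (hS : S.Nonempty) {b : X} (hb : IsGLB S b) :
    leftEndpoint S = b :=
  (isGLB_leftEndpoint hS).unique hb

theorem exists_lt_mem_cell (P : Finset X) {a x : X} (hx : x ∈ cell P a) :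
    ∃ y ∈ cell P a, y < x := by
  obtain ⟨y, hay, hyx⟩ := exists_between hx.1
  exact ⟨y, ⟨hay, fun p hp hap => hyx.trans (hx.2 p hp hap)⟩, hyx⟩

theorem isGLB_cell (P : Finset X) (a : X) : IsGLB (cell P a) a := by
  refine ⟨fun x hx => hx.1.le, fun m hm => ?_⟩
  by_contra hcon
  obtain ⟨x, hx⟩ := cell_nonempty P a
  obtain ⟨y, hay, hy⟩ := exists_between (lt_min hx.1 (not_le.1 hcon))
  have : y ∈ cell P a :=
    ⟨hay, fun p hp hap => (hy.trans_le (min_le_left _ _)).trans (hx.2 p hp hap)⟩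
  exact absurd (hm this) (not_le.2 (hy.trans_le (min_le_right _ _)))

/-- A cell has no least element, so it contains two points to compare. Increasing cells therefore
contribute nothing to `flipNumber`. -/
theorem not_strictAntiOn_cell_of_strictMonoOn {h : X → X} {P : Finset X} {a : X}
    (hm : StrictMonoOn h (cell P a)) : ¬ StrictAntiOn h (cell P a) := by
  intro ha
  obtain ⟨x, hx⟩ := cell_nonempty P a
  obtain ⟨y, hy, hyx⟩ := exists_lt_mem_cell P hx
  exact lt_asymm (hm hy hx hyx) (ha hy hx hyx)

section

variable {h : Equiv.Perm X}

theorem strictMonoOn_or_strictAntiOn_cell (P : AssocPartition h) {a : X} (ha : a ∈ P.leftEnds) :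
    StrictMonoOn h (cell P.leftEnds a) ∨ StrictAntiOn h (cell P.leftEnds a) := by
  have : Inhabited X := ⟨0⟩
  by_contra! hcon
  simp only [StrictMonoOn, StrictAntiOn, not_forall] at hcon
  obtain ⟨⟨x, hx, y, hy, hxy, h1⟩, ⟨x', hx', y', hy', hxy', h2⟩⟩ := hcon
  -- The pairs that refute the two kinds of monotonicity lie in a common closed interval inside the
  -- cell, where a continuous injection is strictly monotone.
  have hmin : min x x' ∈ cell P.leftEnds a := by rcases min_choice x x' with e | e <;> rwa [e]
  have hmax : max y y' ∈ cell P.leftEnds a := by rcases max_choice y y' with e | e <;> rwa [e]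
  have hle : min x x' ≤ max y y' := (min_le_left _ _).trans (hxy.le.trans (le_max_left _ _))
  have hsub := (cell_ordConnected P.leftEnds a).out hmin hmax
  have mx : x ∈ Set.Icc (min x x') (max y y') := ⟨min_le_left _ _, hxy.le.trans (le_max_left _ _)⟩
  have my : y ∈ Set.Icc (min x x') (max y y') := ⟨(min_le_left _ _).trans hxy.le, le_max_left _ _⟩
  have mx' : x' ∈ Set.Icc (min x x') (max y y') :=
    ⟨min_le_right _ _, hxy'.le.trans (le_max_right _ _)⟩
  have my' : y' ∈ Set.Icc (min x x') (max y y') :=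
    ⟨(min_le_right _ _).trans hxy'.le, le_max_right _ _⟩
  rcases ((P.cont a ha).mono hsub).strictMonoOn_of_injOn_Icc' hle h.injective.injOn with hm | hm
  · exact h1 (hm mx my hxy)
  · exact h2 (hm mx' my' hxy')

theorem imageLeft_lt (P : AssocPartition h) {a y : X} (ha : a ∈ P.leftEnds)
    (hy : y ∈ h '' cell P.leftEnds a) : imageLeft P a < y :=
  lt_of_le_of_ne (leftEndpoint_le hy) fun he => imageLeft_notMem P ha (he ▸ hy)

theorem imageLeft_eq (P : AssocPartition h) {a b : X} (hb : IsGLB (h '' cell P.leftEnds a) b) :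
    imageLeft P a = b :=
  leftEndpoint_eq (image_cell_nonempty P a) hb

theorem defaultFun_apply (P : AssocPartition h) {a : X} (ha : a ∈ P.leftEnds) :
    defaultFun P (h a) = imageLeft P a := by
  unfold defaultFun
  rw [if_pos (by simpa using ha)]
  simp

theorem defaultFun_of_notMem (P : AssocPartition h) {a : X} (ha : a ∉ P.leftEnds) :
    defaultFun P (h a) = h a := by
  unfold defaultFun
  rw [if_neg (by simpa using ha)]

theorem defaultPerm_apply (P : AssocPartition h) (y : X) : (defaultPerm P).1 y = defaultFun P y :=
  rfl

theorem AssocPartition.ext_leftEnds {P Q : AssocPartition h} (e : P.leftEnds = Q.leftEnds) :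
    P = Q := by
  cases P; cases Q; cases e; rfl

theorem flipNumber_cast (P : AssocPartition h) [DecidablePred fun a =>
    StrictAntiOn h (cell P.leftEnds a)] : (flipNumber P : ZMod 2) =
      ∑ a ∈ P.leftEnds, if StrictAntiOn h (cell P.leftEnds a) then 1 else 0 := by
  rw [flipNumber, Finset.natCast_card_filter]
  exact Finset.sum_congr rfl fun a _ => by congr

/-- A partition refining an associated partition is associated. -/
def AssocPartition.refine (P : AssocPartition h) (Q : Finset X) (hQ : P.leftEnds ⊆ Q) :
    AssocPartition h where
  leftEnds := Q
  zero_mem := hQ P.zero_mem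
  cont := by
    intro q _ x hx
    obtain ⟨a, ha, hxa⟩ := exists_cell P.zero_mem fun hxP => cell_subset_compl hx (hQ hxP)
    exact ((P.cont a ha).continuousAt ((cell_isOpen _ _).mem_nhds hxa)).continuousWithinAt

/-! #### Adding one point to a partition -/

section insert

variable [DecidableEq X] {P : Finset X} {a c : X}

theorem cell_insert_of_ne (ha : a ∈ P) (hc : c ∈ cell P a) {b : X} (hb : b ∈ P) (hba : b ≠ a) :
    cell (insert c P) b = cell P b := by
  ext x
  refine ⟨fun hx => ⟨hx.1, fun p hp => hx.2 p (Finset.mem_insert_of_mem hp)⟩,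
    fun hx => ⟨hx.1, fun p hp hbp => ?_⟩⟩
  rcases Finset.mem_insert.1 hp with rfl | hp
  · by_contra hcon
    exact hba (cell_unique hb ha
      ⟨hbp, fun q hq hbq => (not_lt.1 hcon).trans_lt (hx.2 q hq hbq)⟩ hc)
  · exact hx.2 p hp hbp

theorem cell_insert_left (hc : c ∈ cell P a) : cell (insert c P) a = cell P a ∩ Set.Iio c := by
  ext x
  refine ⟨fun hx => ⟨⟨hx.1, fun p hp => hx.2 p (Finset.mem_insert_of_mem hp)⟩,
    hx.2 c (Finset.mem_insert_self _ _) hc.1⟩, fun hx => ⟨hx.1.1, fun p hp hap => ?_⟩⟩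
  rcases Finset.mem_insert.1 hp with rfl | hp
  · exact hx.2
  · exact hx.1.2 p hp hap

theorem cell_insert_right (hc : c ∈ cell P a) : cell (insert c P) c = cell P a ∩ Set.Ioi c := by
  ext x
  refine ⟨fun hx => ⟨⟨hc.1.trans hx.1, fun p hp hap => ?_⟩, hx.1⟩,
    fun hx => ⟨hx.2, fun p hp hcp => ?_⟩⟩
  · exact hx.2 p (Finset.mem_insert_of_mem hp) (hc.2 p hp hap)
  · rcases Finset.mem_insert.1 hp with rfl | hp
    · exact absurd hcp (lt_irrefl _)
    · exact hx.1.2 p hp (hc.1.trans hcp)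

end insert

theorem image_cell_isGLB (P : AssocPartition h) (a : X) :
    IsGLB (h '' cell P.leftEnds a) (imageLeft P a) :=
  isGLB_leftEndpoint (image_cell_nonempty P a)

/-- If `h` increases on the cell containing `c`, the left half keeps the old image endpoint and the
right half gets `h c`, which the old default already fixed. If `h` decreases, the two halves receive
these endpoints in the opposite order: the default gains the transposition of `h a` and `h c`, and
there is one more flip. -/
theorem epsOf_refine_insert (P : AssocPartition h) (c : X) :
    epsOf (P.refine (insert c P.leftEnds) (Finset.subset_insert _ _)) = epsOf P := by
  classical
  by_cases hcP : c ∈ P.leftEnds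
  · congr 1
    exact AssocPartition.ext_leftEnds (Finset.insert_eq_self.2 hcP)
  obtain ⟨a, ha, hc⟩ := exists_cell P.zero_mem hcP
  set P' := P.refine (insert c P.leftEnds) (Finset.subset_insert _ _) with hP'
  have hl : P'.leftEnds = insert c P.leftEnds := rfl
  have hcell : ∀ b ∈ P.leftEnds, b ≠ a → cell P'.leftEnds b = cell P.leftEnds b :=
    fun b hb hba => cell_insert_of_ne ha hc hb hba
  have hcella : cell P'.leftEnds a = cell P.leftEnds a ∩ Set.Iio c := cell_insert_left hc
  have hcellc : cell P'.leftEnds c = cell P.leftEnds a ∩ Set.Ioi c := cell_insert_right hc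
  have haP' : a ∈ P'.leftEnds := Finset.mem_insert_of_mem ha
  have hcP' : c ∈ P'.leftEnds := Finset.mem_insert_self _ _
  have hmemP' : ∀ x, x ∉ P.leftEnds → x ≠ c → x ∉ P'.leftEnds := by
    intro x hx hxc
    simp [hl, hx, hxc]
  have himg : ∀ b ∈ P.leftEnds, b ≠ a → imageLeft P' b = imageLeft P b := by
    intro b hb hba
    rw [imageLeft, imageLeft, hcell b hb hba]
  have hcont : ContinuousAt h c :=
    (P.cont a ha).continuousAt ((cell_isOpen _ _).mem_nhds hc)
  have hnear := (cell_isOpen P.leftEnds a).mem_nhds hc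
  -- Continuity at `c` lets a lower bound for `h` on one side of `c` pass to `h c`; `hlt` is the
  -- same from the left.
  have hgt : ∀ m : X, (∀ y ∈ cell P.leftEnds a ∩ Set.Ioi c, m ≤ h y) → m ≤ h c := by
    intro m hm
    refine ge_of_tendsto (hcont.tendsto.mono_left nhdsWithin_le_nhds : Filter.Tendsto h
      (nhdsWithin c (Set.Ioi c)) _) ?_
    filter_upwards [nhdsWithin_le_nhds hnear, self_mem_nhdsWithin] with y hy hy'
    exact hm y ⟨hy, hy'⟩
  have hlt : ∀ m : X, (∀ y ∈ cell P.leftEnds a ∩ Set.Iio c, m ≤ h y) → m ≤ h c := by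
    intro m hm
    have : (nhdsWithin c (Set.Iio c)).NeBot := nhdsLT_neBot_of_exists_lt ⟨a, hc.1⟩
    refine ge_of_tendsto (hcont.tendsto.mono_left nhdsWithin_le_nhds : Filter.Tendsto h
      (nhdsWithin c (Set.Iio c)) _) ?_
    filter_upwards [nhdsWithin_le_nhds hnear, self_mem_nhdsWithin] with y hy hy'
    exact hm y ⟨hy, hy'⟩
  have hglb := image_cell_isGLB P a
  have hsum : ∑ b ∈ P.leftEnds.erase a,
      (if StrictAntiOn h (cell P'.leftEnds b) then (1 : ZMod 2) else 0) =
      ∑ b ∈ P.leftEnds.erase a, if StrictAntiOn h (cell P.leftEnds b) then 1 else 0 := by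
    refine Finset.sum_congr rfl fun b hb => ?_
    rw [hcell b (Finset.mem_of_mem_erase hb) (Finset.ne_of_mem_erase hb)]
  rw [epsOf, epsOf, flipNumber_cast, flipNumber_cast]
  simp only [hl] at hsum ⊢
  rw [Finset.sum_insert hcP, ← Finset.add_sum_erase _ _ ha, hsum, ← Finset.add_sum_erase _ _ ha]
  simp only [← hl]
  rcases strictMonoOn_or_strictAntiOn_cell P ha with hm | hm
  · have hma := not_strictAntiOn_cell_of_strictMonoOn (P := P'.leftEnds) (a := a)
      (hcella ▸ hm.mono Set.inter_subset_left)
    have hmc := not_strictAntiOn_cell_of_strictMonoOn (P := P'.leftEnds) (a := c)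
      (hcellc ▸ hm.mono Set.inter_subset_left)
    have e1 : imageLeft P' a = imageLeft P a := by
      refine imageLeft_eq P' ?_
      rw [hcella]
      refine ⟨lowerBounds_mono_set (Set.image_mono Set.inter_subset_left) hglb.1,
        fun m hm' => hglb.2 ?_⟩
      rintro _ ⟨x, hx, rfl⟩
      rcases lt_or_ge x c with hxc | hxc
      · exact hm' ⟨x, ⟨hx, hxc⟩, rfl⟩
      · obtain ⟨y, hy, hyc⟩ := exists_lt_mem_cell _ hc
        exact (hm' ⟨y, ⟨hy, hyc⟩, rfl⟩).trans (hm hy hx (hyc.trans_le hxc)).le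
    have e2 : imageLeft P' c = h c := by
      refine imageLeft_eq P' ?_
      rw [hcellc]
      refine ⟨?_, fun m hm' => hgt m fun y hy => hm' ⟨y, hy, rfl⟩⟩
      rintro _ ⟨x, hx, rfl⟩
      exact (hm hc hx.1 hx.2).le
    have e3 : defaultPerm P' = defaultPerm P := by
      refine Subtype.ext (Equiv.ext fun y => ?_)
      rw [defaultPerm_apply, defaultPerm_apply]
      obtain ⟨x, rfl⟩ := h.surjective y
      by_cases hx : x ∈ P.leftEnds
      · rw [defaultFun_apply P hx, defaultFun_apply P' (Finset.mem_insert_of_mem hx)]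
        rcases eq_or_ne x a with rfl | hxa
        · exact e1
        · exact himg x hx hxa
      · rw [defaultFun_of_notMem P hx]
        rcases eq_or_ne x c with rfl | hxc
        · rw [defaultFun_apply P' hcP', e2]
        · rw [defaultFun_of_notMem P' (hmemP' x hx hxc)]
    rw [if_neg hmc, if_neg hma, if_neg (not_strictAntiOn_cell_of_strictMonoOn hm), e3, zero_add]
  · have hma : StrictAntiOn h (cell P'.leftEnds a) := hcella ▸ hm.mono Set.inter_subset_left
    have hmc : StrictAntiOn h (cell P'.leftEnds c) := hcellc ▸ hm.mono Set.inter_subset_left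
    have e1 : imageLeft P' c = imageLeft P a := by
      refine imageLeft_eq P' ?_
      rw [hcellc]
      refine ⟨lowerBounds_mono_set (Set.image_mono Set.inter_subset_left) hglb.1,
        fun m hm' => hglb.2 ?_⟩
      have hmc' := hgt m fun y hy => hm' ⟨y, hy, rfl⟩
      rintro _ ⟨x, hx, rfl⟩
      rcases lt_or_ge c x with hxc | hxc
      · exact hm' ⟨x, ⟨hx, hxc⟩, rfl⟩
      · exact hmc'.trans (hm.antitoneOn hx hc hxc)
    have e2 : imageLeft P' a = h c := by
      refine imageLeft_eq P' ?_
      rw [hcella]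
      refine ⟨?_, fun m hm' => hlt m fun y hy => hm' ⟨y, hy, rfl⟩⟩
      rintro _ ⟨x, hx, rfl⟩
      exact (hm hx.1 hc hx.2).le
    have hac : h a ≠ h c := fun e => hc.1.ne (h.injective e)
    have e3 : defaultPerm P' = defaultPerm P * finSwap (h a) (h c) := by
      refine Subtype.ext (Equiv.ext fun y => ?_)
      change defaultFun P' y = defaultFun P (Equiv.swap (h a) (h c) y)
      obtain ⟨x, rfl⟩ := h.surjective y
      rcases eq_or_ne x a with rfl | hxa
      · rw [Equiv.swap_apply_left, defaultFun_apply P' haP', e2, defaultFun_of_notMem P hcP]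
      rcases eq_or_ne x c with rfl | hxc
      · rw [Equiv.swap_apply_right, defaultFun_apply P' hcP', e1, defaultFun_apply P ha]
      rw [Equiv.swap_apply_of_ne_of_ne (h.injective.ne hxa) (h.injective.ne hxc)]
      by_cases hx : x ∈ P.leftEnds
      · rw [defaultFun_apply P hx, defaultFun_apply P' (Finset.mem_insert_of_mem hx),
          himg x hx hxa]
      · rw [defaultFun_of_notMem P hx, defaultFun_of_notMem P' (hmemP' x hx hxc)]
    rw [if_pos hmc, if_pos hma, if_pos hm, e3, epsFin_mul, epsFin_finSwap hac]
    -- The extra flip and the odd transposition contribute one each.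
    have h2 : (1 : ZMod 2) + 1 = 0 := by decide
    linear_combination h2

theorem epsOf_eq_of_subset {P Q : AssocPartition h} (hPQ : P.leftEnds ⊆ Q.leftEnds) :
    epsOf Q = epsOf P := by
  classical
  have key : ∀ s : Finset X,
      epsOf (P.refine (s ∪ P.leftEnds) Finset.subset_union_right) = epsOf P := by
    intro s
    induction s using Finset.induction_on with
    | empty =>
      congr 1
      exact AssocPartition.ext_leftEnds (Finset.empty_union _)
    | insert c s _ ih =>
      rw [← ih, ← epsOf_refine_insert (P.refine (s ∪ P.leftEnds) _) c]
      congr 1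
      exact AssocPartition.ext_leftEnds (Finset.insert_union _ _ _)
  rw [← key Q.leftEnds]
  congr 1
  exact AssocPartition.ext_leftEnds (Finset.union_eq_left.2 hPQ).symm

end

theorem eps_eq_epsOf (h : PChat) (P : AssocPartition h.1) : eps h = epsOf P :=
  (epsOf_eq_of_subset (minPartition_leftEnds_subset h P)).symm

/-! ### The signature is a homomorphism -/

section comp

variable {f g : Equiv.Perm X} [DecidableEq X]

/-- The image of a cell is an interval. A point of the image partition above its infimum and not
above some member would lie in it, and so be the image both of a cut point and of an interior point.
-/
theorem image_cell_subset (P : AssocPartition g) {a : X} (ha : a ∈ P.leftEnds) :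
    g '' cell P.leftEnds a ⊆ cell (P.leftEnds.image g) (imageLeft P a) := by
  intro y hy
  refine ⟨imageLeft_lt P ha hy, fun p hp hap => ?_⟩
  by_contra hcon
  obtain ⟨w, hw, hwp⟩ := exists_lt_of_leftEndpoint_lt (image_cell_nonempty P a) hap
  obtain ⟨x, hx, hxp⟩ := (image_cell_ordConnected P ha).out hw hy ⟨hwp.le, not_lt.1 hcon⟩
  obtain ⟨b, hb, rfl⟩ := Finset.mem_image.1 hp
  rw [g.injective hxp] at hx
  exact cell_subset_compl hx hb

theorem imageLeft_mem_image (P : AssocPartition g) {a : X} (ha : a ∈ P.leftEnds) :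
    imageLeft P a ∈ P.leftEnds.image g :=
  Finset.mem_image.2 ⟨_, inv_imageLeft_mem P ha, by simp⟩

/-- A piecewise continuous bijection maps the interiors of the intervals of a partition onto the
interiors of the intervals of the image partition. -/
theorem image_cell_eq (P : AssocPartition g) {a : X} (ha : a ∈ P.leftEnds) :
    g '' cell P.leftEnds a = cell (P.leftEnds.image g) (imageLeft P a) := by
  refine (image_cell_subset P ha).antisymm fun y hy => ?_
  obtain ⟨x, rfl⟩ := g.surjective y
  have hx : x ∉ P.leftEnds := fun hx =>
    cell_subset_compl hy (Finset.mem_image_of_mem g hx)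
  -- The point lies in the image of some cell `b`, hence in the target cell of `b`. Target cells are
  -- disjoint and `imageLeft` is injective, so `b = a`.
  obtain ⟨b, hb, hxb⟩ := exists_cell P.zero_mem hx
  have hyb := image_cell_subset P hb (Set.mem_image_of_mem g hxb)
  have := cell_unique (imageLeft_mem_image P ha) (imageLeft_mem_image P hb) hy hyb
  rw [imageLeft_injOn P ha hb this]
  exact Set.mem_image_of_mem g hxb

/-- An injective map into a set with no more elements is onto. This allows sums over the partition
for `f` to be indexed by the cells of the partition for `g`. -/
theorem image_imageLeft (P : AssocPartition g) :
    P.leftEnds.image (imageLeft P) = P.leftEnds.image g := by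
  have hinj : Set.InjOn (imageLeft P) P.leftEnds := fun a ha b hb => imageLeft_injOn P ha hb
  refine Finset.eq_of_subset_of_card_le (fun x hx => ?_) ?_
  · obtain ⟨a, ha, rfl⟩ := Finset.mem_image.1 hx
    exact imageLeft_mem_image P ha
  · rw [Finset.card_image_of_injOn hinj]
    exact Finset.card_image_le

theorem cell_image_imageLeft (P : AssocPartition g) {Q : AssocPartition f}
    (hQ : Q.leftEnds = P.leftEnds.image g) {a : X} (ha : a ∈ P.leftEnds) :
    (f * g : Equiv.Perm X) '' cell P.leftEnds a = f '' cell Q.leftEnds (imageLeft P a) := by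
  rw [hQ, ← image_cell_eq P ha, Set.image_image]
  rfl

/-- The partition of a composition. -/
def AssocPartition.comp (Q : AssocPartition f) (P : AssocPartition g)
    (hQ : Q.leftEnds = P.leftEnds.image g) : AssocPartition (f * g) where
  leftEnds := P.leftEnds
  zero_mem := P.zero_mem
  cont := by
    intro a ha
    refine ContinuousOn.comp (g := f) (Q.cont (imageLeft P a) ?_) (P.cont a ha) ?_
    · rw [hQ]
      exact imageLeft_mem_image P ha
    · rw [hQ, ← image_cell_eq P ha]
      exact Set.mapsTo_image g _

/-- The default of `f * g` first moves `f (g a)` as the default of `g` moves `g a`, transported by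
`f`, and then applies the default of `f`. Flips add modulo 2 because a composite of two decreasing
maps is increasing. -/
theorem epsOf_comp (Q : AssocPartition f) (P : AssocPartition g)
    (hQ : Q.leftEnds = P.leftEnds.image g) : epsOf (Q.comp P hQ) = epsOf Q + epsOf P := by
  classical
  have hl : (Q.comp P hQ).leftEnds = P.leftEnds := rfl
  have hQmem : ∀ {a}, a ∈ P.leftEnds → imageLeft P a ∈ Q.leftEnds := fun ha =>
    hQ ▸ imageLeft_mem_image P ha
  have hleft : ∀ a ∈ P.leftEnds,
      imageLeft (Q.comp P hQ) a = imageLeft Q (imageLeft P a) := by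
    intro a ha
    rw [imageLeft, hl, cell_image_imageLeft P hQ ha]
    rfl
  let τ : Sfin := ⟨f * (defaultPerm P).1 * f⁻¹, Sfin_normal.conj_mem _ (defaultPerm P).2 f⟩
  have hperm : defaultPerm (Q.comp P hQ) = defaultPerm Q * τ := by
    refine Subtype.ext (Equiv.ext fun y => ?_)
    obtain ⟨x, rfl⟩ := (f * g).surjective y
    change defaultFun (Q.comp P hQ) ((f * g) x) =
      defaultFun Q (f (defaultFun P (f⁻¹ (f (g x)))))
    have hinv : f⁻¹ (f (g x)) = g x := by simp
    rw [hinv]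
    by_cases hx : x ∈ P.leftEnds
    · rw [defaultFun_apply P hx, defaultFun_apply Q (hQmem hx), defaultFun_apply _ (hl ▸ hx),
        hleft x hx]
    · rw [defaultFun_of_notMem P hx, defaultFun_of_notMem _ (hl ▸ hx),
        defaultFun_of_notMem Q]
      · rfl
      · rw [hQ]
        intro hm
        obtain ⟨b, hb, hbx⟩ := Finset.mem_image.1 hm
        exact hx (g.injective hbx ▸ hb)
  have hflip : ∀ a ∈ P.leftEnds,
      (if StrictAntiOn (f * g : Equiv.Perm X) (cell P.leftEnds a) then (1 : ZMod 2) else 0) =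
        (if StrictAntiOn f (cell Q.leftEnds (imageLeft P a)) then 1 else 0) +
          if StrictAntiOn g (cell P.leftEnds a) then 1 else 0 := by
    intro a ha
    have hmaps : Set.MapsTo g (cell P.leftEnds a) (cell Q.leftEnds (imageLeft P a)) := by
      rw [hQ, ← image_cell_eq P ha]
      exact Set.mapsTo_image g _
    rcases strictMonoOn_or_strictAntiOn_cell P ha with hg | hg <;>
      rcases strictMonoOn_or_strictAntiOn_cell Q (hQmem ha) with hf | hf
    · have : StrictMonoOn (f * g : Equiv.Perm X) (cell P.leftEnds a) := hf.comp hg hmaps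
      rw [if_neg (not_strictAntiOn_cell_of_strictMonoOn hf),
        if_neg (not_strictAntiOn_cell_of_strictMonoOn hg),
        if_neg (not_strictAntiOn_cell_of_strictMonoOn this), add_zero]
    · have : StrictAntiOn (f * g : Equiv.Perm X) (cell P.leftEnds a) :=
        hf.comp_strictMonoOn hg hmaps
      rw [if_pos hf, if_neg (not_strictAntiOn_cell_of_strictMonoOn hg), if_pos this, add_zero]
    · have : StrictAntiOn (f * g : Equiv.Perm X) (cell P.leftEnds a) :=
        hf.comp_strictAntiOn hg hmaps
      rw [if_neg (not_strictAntiOn_cell_of_strictMonoOn hf), if_pos hg, if_pos this, zero_add]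
    · have : StrictMonoOn (f * g : Equiv.Perm X) (cell P.leftEnds a) := hf.comp hg hmaps
      rw [if_pos hf, if_pos hg, if_neg (not_strictAntiOn_cell_of_strictMonoOn this)]
      decide
  have hsum : (flipNumber (Q.comp P hQ) : ZMod 2) = flipNumber Q + flipNumber P := by
    rw [flipNumber_cast, flipNumber_cast, flipNumber_cast, hl, Finset.sum_congr rfl hflip,
      Finset.sum_add_distrib]
    congr 1
    -- A cell `a` for `g` corresponds to the cell for `f` starting at `imageLeft P a`, not at `g a`;
    -- the sum must be reindexed along the former.
    conv_rhs => rw [hQ, ← image_imageLeft P]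
    rw [Finset.sum_image fun a ha b hb => imageLeft_injOn P ha hb, image_imageLeft P, hQ]
  rw [epsOf, epsOf, epsOf, hsum, hperm, epsFin_mul, epsFin_conj f (defaultPerm P) τ rfl]
  ring

end comp

theorem eps_mul (f g : PChat) : eps (f * g) = eps f + eps g := by
  classical
  -- The cut points of `f` are pulled back by `g`, so that the image of `P` under `g` refines the
  -- minimal partition of `f`.
  let P := (minPartition g).refine
    ((minPartition g).leftEnds ∪ (minPartition f).leftEnds.image ⇑(g.1⁻¹)) Finset.subset_union_left
  have hsub : (minPartition f).leftEnds ⊆ P.leftEnds.image g.1 := by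
    intro x hx
    refine Finset.mem_image.2 ⟨g.1⁻¹ x, Finset.mem_union_right _ (Finset.mem_image_of_mem _ hx), ?_⟩
    simp
  rw [eps_eq_epsOf f ((minPartition f).refine _ hsub), eps_eq_epsOf g P, ← epsOf_comp _ P rfl]
  exact eps_eq_epsOf (f * g) _

/-- The signature extends the classical signature. -/
theorem eps_of_mem_Sfin (h : PChat) (hh : h.1 ∈ Sfin) : eps h = epsFin ⟨h.1, hh⟩ := by
  classical
  obtain ⟨h, hPC⟩ := h
  change h ∈ Sfin at hh
  have hfix : ∀ {x}, x ∉ insert 0 (Set.Finite.toFinset hh) → h x = x := by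
    intro x hx
    by_contra hcon
    exact hx (Finset.mem_insert_of_mem ((Set.Finite.mem_toFinset _).2 hcon))
  -- Cutting at every moved point makes `h` the identity on each cell. There are no flips, and the
  -- default sends `h a` back to `a`, so it is the inverse of `h`.
  let P : AssocPartition h :=
    { leftEnds := insert 0 (Set.Finite.toFinset hh)
      zero_mem := Finset.mem_insert_self _ _
      cont := fun a _ => continuousOn_id.congr fun x hx => hfix (cell_subset_compl hx) }
  have hid : ∀ a, Set.EqOn h id (cell P.leftEnds a) := fun a x hx => hfix (cell_subset_compl hx)
  have hmono : ∀ a, StrictMonoOn h (cell P.leftEnds a) := fun a =>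
    strictMonoOn_id.congr (hid a).symm
  have hleft : ∀ a, imageLeft P a = a := by
    intro a
    refine imageLeft_eq P ?_
    rw [(hid a).image_eq, Set.image_id]
    exact isGLB_cell _ _
  have hperm : defaultPerm P = (⟨h, hh⟩ : Sfin)⁻¹ := by
    refine Subtype.ext (Equiv.ext fun y => ?_)
    obtain ⟨x, rfl⟩ := h.surjective y
    change defaultFun P (h x) = h⁻¹ (h x)
    have hinv : h⁻¹ (h x) = x := by simp
    rw [hinv]
    by_cases hx : x ∈ P.leftEnds
    · rw [defaultFun_apply P hx, hleft]
    · rw [defaultFun_of_notMem P hx, hfix hx]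
  rw [eps_eq_epsOf ⟨h, hPC⟩ P, epsOf, hperm, epsFin_inv, flipNumber_cast,
    Finset.sum_eq_zero fun a _ => if_neg (not_strictAntiOn_cell_of_strictMonoOn (hmono a)),
    zero_add]

/-- The signature, as a homomorphism. -/
noncomputable def epsHom : PChat →* Multiplicative (ZMod 2) :=
  MonoidHom.mk' (fun h => Multiplicative.ofAdd (eps h)) fun f g => by
    rw [eps_mul, ofAdd_add]

theorem epsHom_apply (h : PChat) : epsHom h = Multiplicative.ofAdd (eps h) := rfl

/-! ### The normal subgroups of `Ghat` -/

theorem mem_AfinPC_iff (h : PChat) : h ∈ AfinPC ↔ h ∈ SfinPC ∧ epsHom h = 1 := by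
  rw [epsHom_apply, ofAdd_eq_one, Subgroup.mem_subgroupOf, Subgroup.mem_subgroupOf]
  constructor
  · rintro ⟨σ, hσ, hσh⟩
    have hh : h.1 ∈ Sfin := hσh ▸ σ.2
    refine ⟨hh, ?_⟩
    rw [eps_of_mem_Sfin h hh, epsFin_eq_zero_iff]
    rwa [show (⟨h.1, hh⟩ : Sfin) = σ from Subtype.ext hσh.symm]
  · rintro ⟨hh, he⟩
    rw [eps_of_mem_Sfin h hh, epsFin_eq_zero_iff] at he
    exact ⟨⟨h.1, hh⟩, he, rfl⟩

theorem normal_subgroups {Ghat : Subgroup PChat} (hS : SfinPC ≤ Ghat)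
    (hsimple : IsSimpleGroup (Ghat.map (QuotientGroup.mk' SfinPC)))
    (hcomm : ∃ a b : Ghat.map (QuotientGroup.mk' SfinPC), a * b ≠ b * a) :
    {N : Subgroup Ghat | N.Normal} = {⊥, AfinPC.subgroupOf Ghat, SfinPC.subgroupOf Ghat,
        epsHom.ker.subgroupOf Ghat, ⊤} ∧
      {N : Subgroup Ghat | N.Normal}.ncard = 5 := by
  let π := (QuotientGroup.mk' SfinPC).subgroupMap Ghat
  let ε := epsHom.comp Ghat.subtype
  have hπ : π.ker = SfinPC.subgroupOf Ghat := by
    ext x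
    rw [MonoidHom.mem_ker, Subtype.ext_iff]
    exact QuotientGroup.eq_one_iff x.1
  have hε : ε.ker = epsHom.ker.subgroupOf Ghat := rfl
  have hAeq : AfinPC.subgroupOf Ghat = π.ker ⊓ ε.ker := by
    ext x
    rw [hπ]
    exact mem_AfinPC_iff x.1
  -- finitely supported permutations as elements of `Ghat`
  have hmem : ∀ σ ∈ Sfin, ∃ x : Ghat, x.1.1 = σ := fun σ hσ =>
    ⟨⟨⟨σ, Sfin_le_PChat hσ⟩, hS hσ⟩, rfl⟩
  have hswap : ¬ π.ker ≤ ε.ker := by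
    intro hle
    obtain ⟨a, b, hab⟩ := exists_pair_ne X
    obtain ⟨x, hx⟩ := hmem _ (swap_mem_Sfin a b)
    have hxS : x.1.1 ∈ Sfin := hx ▸ swap_mem_Sfin a b
    have h1 : epsHom x.1 = 1 := hle (by rw [hπ]; exact hxS)
    rw [epsHom_apply, ofAdd_eq_one, eps_of_mem_Sfin _ hxS,
      show (⟨x.1.1, hxS⟩ : Sfin) = finSwap a b from Subtype.ext hx, epsFin_finSwap hab] at h1
    exact one_ne_zero h1
  have hA0 : AfinPC.subgroupOf Ghat ≠ ⊥ := by
    intro h0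
    obtain ⟨σ, hσ, hσ1⟩ := Afin.bot_or_exists_ne_one.resolve_left Afin_ne_bot
    have hσS : σ ∈ Sfin := by
      obtain ⟨τ, -, rfl⟩ := hσ
      exact τ.2
    obtain ⟨x, hx⟩ := hmem σ hσS
    have hxA : x ∈ AfinPC.subgroupOf Ghat := show x.1.1 ∈ Afin from hx ▸ hσ
    rw [h0, Subgroup.mem_bot] at hxA
    exact hσ1 (by rw [← hx, hxA]; rfl)
  have hmin : ∀ N : Subgroup Ghat, N.Normal → N ≠ ⊥ → AfinPC.subgroupOf Ghat ≤ N := by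
    intro N hN hN0
    -- Viewed among all permutations of `X`, the image of `N` need not be normal, but it is
    -- normalized by the transpositions, since these belong to `Ghat`.
    let j : Ghat →* Equiv.Perm X := PChat.subtype.comp Ghat.subtype
    have hj : Function.Injective j := PChat.subtype_injective.comp Ghat.subtype_injective
    have hle : Afin ≤ N.map j := by
      refine Afin_le_of_normalized ?_ fun h => hN0 ((Subgroup.map_eq_bot_iff_of_injective N hj).1 h)
      rintro _ ⟨n, hn, rfl⟩ a b
      obtain ⟨x, hx⟩ := hmem _ (swap_mem_Sfin a b)
      refine ⟨x * n * x⁻¹, hN.conj_mem n hn x, ?_⟩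
      rw [map_mul, map_mul, map_inv, show j x = Equiv.swap a b from hx]
    intro x hx
    obtain ⟨n, hn, hnx⟩ := hle (show j x ∈ Afin from hx)
    rwa [← hj hnx]
  rw [← hπ, ← hε]
  refine normal_subgroups_of_simple_quotient π
    ((QuotientGroup.mk' SfinPC).subgroupMap_surjective Ghat) hcomm ε ?_ hAeq hA0 hswap hmin
  intro s t
  have : ∀ u v : Multiplicative (ZMod 2), u ≠ 1 → v ≠ 1 → u = v := by decide
  exact this _ _

end PC

theorem theorem2 :
    ∃ ε : PC.PChat →* Multiplicative (ZMod 2),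
      (∀ h : PC.PChat, ε h = Multiplicative.ofAdd (PC.eps h)) ∧
      ∀ Ghat : Subgroup PC.PChat, PC.SfinPC ≤ Ghat →
        IsSimpleGroup (Ghat.map (QuotientGroup.mk' PC.SfinPC)) →
        (∃ a b : Ghat.map (QuotientGroup.mk' PC.SfinPC), a * b ≠ b * a) →
        {N : Subgroup Ghat | N.Normal} =
            {⊥, PC.AfinPC.subgroupOf Ghat, PC.SfinPC.subgroupOf Ghat, ε.ker.subgroupOf Ghat, ⊤} ∧
          {N : Subgroup Ghat | N.Normal}.ncard = 5 :=
  ⟨PC.epsHom, PC.epsHom_apply, fun _ hS hsimple hcomm => PC.normal_subgroups hS hsimple hcomm⟩
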